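/- Let $\Omega=\{0,1\}^{\infty}$ carry the product topology, and let $\Sigma$ be a $\sigma$-algebra on $\Omega$ that contains all cylinders (hence all open sets). An \emph{opinion} is a finitely additive probability $P$ on $(\Omega,\Sigma)$ that is strongly nonatomic: for every $E\in\Sigma$ and every $\alpha\in[0,1]$ there is $F\in\Sigma$ with $F\subseteq E$ and $P(F)=\alpha P(E)$. Let $\Delta$ be the set of all opinions. A \emph{test} is a function $T$ that assigns to each $P\in\Delta$ an open set $T(P)\subseteq\Omega$. Let $\varepsilon\in[0,1)$ and let $T$ be a test that $\Delta$-controls for type I error with probability $1-\varepsilon$, that is, $P(T(P))\le\varepsilon$ for every $P\in\Delta$. Then for every $\delta\in(0,1-\varepsilon]$ the test $T$ can be manipulated with probability $1-\varepsilon-\delta$, that is, there is a probability measure $\zeta$ on $\Delta$ with finite support such that for every $\omega\in\Omega$ $$\zeta\bigl(\{P\in\Delta:\omega\notin T(P)\}\bigr)\ \ge\ 1-\varepsilon-\delta .$$ -/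

import Mathlib

namespace OpinionTesting

open scoped MeasureTheory

/-- The set `Ω = {0,1}^∞` of all paths, with the product topology. -/
abbrev Paths : Type := ℕ → Fin 2

/-- A σ-algebra `Σ` of events on `Ω` that contains all cylinders
`ω^t = {ω' | ω' agrees with ω in the first t periods}`. -/
structure EventAlgebra where
  sigma : MeasurableSpace Paths
  cylinder_mem : ∀ (ω : Paths) (t : ℕ), MeasurableSet[sigma] (PiNat.cylinder ω t)

/-- The events, that is, the members of `Σ`. -/
abbrev Event (S : EventAlgebra) : Type := {E : Set Paths // MeasurableSet[S.sigma] E}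

/-- Every open set of paths is an event. -/
theorem EventAlgebra.measurableSet_of_isOpen (S : EventAlgebra) {U : Set Paths}
    (hU : IsOpen U) : MeasurableSet[S.sigma] U := by
  have hb := PiNat.isTopologicalBasis_cylinders (E := fun _ : ℕ => Fin 2)
  have hle : borel Paths ≤ S.sigma := by
    rw [hb.borel_eq_generateFrom]
    refine MeasurableSpace.generateFrom_le ?_
    rintro _ ⟨ω, t, rfl⟩
    exact S.cylinder_mem ω t
  exact hle _ (MeasurableSpace.measurableSet_generateFrom hU)

/-- An open set of paths, regarded as an event. -/
def openEvent (S : EventAlgebra) (U : TopologicalSpace.Opens Paths) : Event S :=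
  ⟨U, S.measurableSet_of_isOpen U.isOpen⟩

/-- A finitely additive probability on `(Ω, Σ)`. -/
@[ext]
structure FinAddProb (S : EventAlgebra) where
  prob : Event S → ℝ
  nonneg : ∀ E, 0 ≤ prob E
  prob_univ : prob ⟨Set.univ, @MeasurableSet.univ _ S.sigma⟩ = 1
  prob_union : ∀ E F : Event S, Disjoint E.1 F.1 →
    prob ⟨E.1 ∪ F.1, @MeasurableSet.union _ S.sigma _ _ E.2 F.2⟩ = prob E + prob F

/-- `P` is strongly nonatomic (Savagean). -/
def FinAddProb.StronglyNonatomic {S : EventAlgebra} (P : FinAddProb S) : Prop :=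
  ∀ (E : Event S) (α : ℝ), α ∈ Set.Icc (0 : ℝ) 1 →
    ∃ F : Event S, F.1 ⊆ E.1 ∧ P.prob F = α * P.prob E

/-- The set `Δ` of all opinions: strongly nonatomic finitely additive probabilities. -/
abbrev Opinion (S : EventAlgebra) : Type := {P : FinAddProb S // P.StronglyNonatomic}

/-- A test assigns to each opinion `P` an open set `T P` of paths on which `P` is rejected. -/
abbrev Test (S : EventAlgebra) : Type := Opinion S → TopologicalSpace.Opens Paths

/-- `T` `Λ`-controls for type I error with probability `1 - ε`. -/
def Test.ControlsTypeI {S : EventAlgebra} (T : Test S) (Λ : Set (Opinion S)) (ε : ℝ) : Prop :=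
  ∀ P ∈ Λ, P.1.prob (openEvent S (T P)) ≤ ε

/-- A strategy: a probability measure on the set of opinions with finite support. -/
abbrev Strategy (S : EventAlgebra) : Type := {ζ : PMF (Opinion S) // ζ.support.Finite}

/-- The probability `ζ(A)` of a set `A` of opinions. -/
noncomputable def Strategy.probOf {S : EventAlgebra} (ζ : Strategy S)
    (A : Set (Opinion S)) : ℝ :=
  (ζ.1.toOuterMeasure A).toReal

/-- `T` can be manipulated with probability `q`. -/
def Test.CanBeManipulated {S : EventAlgebra} (T : Test S) (q : ℝ) : Prop :=
  ∃ ζ : Strategy S, ∀ ω : Paths, q ≤ Strategy.probOf ζ {P | ω ∉ T P}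

end OpinionTesting

/-! If no strategy manipulates `T`, every convex combination of rejection indicators exceeds `ε + δ`
at some path. Hahn–Banach (`exists_isMean_forall_le`) then gives one mean `φ` with `φ(1_{T P}) ≥ ε +
δ` for all `P`. Were `φ` an opinion `P`, evaluating at `T P` would contradict type I control.

A mean may have atoms, so `φ` is first smeared: each path `ω` is replaced by the Cesàro mean along
its truncations. These converge to `ω`, so an open set containing `ω` keeps full mass, and open sets
do not lose probability. The position of the last `1` of a truncation is spread thinly over residue
classes, which yields finite covers by events of small probability. Such covers force strong
nonatomicity, as `Σ` is closed under countable unions. -/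

namespace OpinionTesting

open Filter Topology

/-! ### Means on bounded functions -/

/-- A real function with bounded absolute value. -/
def IsBdd {X : Type*} (f : X → ℝ) : Prop := ∃ M, ∀ x, |f x| ≤ M

theorem IsBdd.add {X : Type*} {f g : X → ℝ} (hf : IsBdd f) (hg : IsBdd g) : IsBdd (f + g) := by
  obtain ⟨M, hM⟩ := hf
  obtain ⟨N, hN⟩ := hg
  exact ⟨M + N, fun x => (abs_add_le _ _).trans (add_le_add (hM x) (hN x))⟩

theorem IsBdd.const {X : Type*} (c : ℝ) : IsBdd (fun _ : X => c) := ⟨|c|, fun _ => le_rfl⟩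

theorem IsBdd.comp {X Y : Type*} {f : Y → ℝ} (hf : IsBdd f) (g : X → Y) :
    IsBdd (fun x => f (g x)) :=
  hf.imp fun _ h x => h (g x)

theorem IsBdd.indicator_one {X : Type*} (E : Set X) : IsBdd (E.indicator (1 : X → ℝ)) := by
  refine ⟨1, fun x => ?_⟩
  by_cases h : x ∈ E <;> simp [h]

/-- A monotone, additive and normalised functional on the bounded functions. -/
structure IsMean {X : Type*} (φ : (X → ℝ) → ℝ) : Prop where
  add : ∀ f g, IsBdd f → IsBdd g → φ (f + g) = φ f + φ g
  mono : ∀ f g, IsBdd f → IsBdd g → f ≤ g → φ f ≤ φ g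
  const : ∀ c, φ (fun _ => c) = c

theorem IsMean.abs_le {X : Type*} {φ : (X → ℝ) → ℝ} (hφ : IsMean φ) {f : X → ℝ} {M : ℝ}
    (hf : ∀ x, |f x| ≤ M) : |φ f| ≤ M := by
  have hb : IsBdd f := ⟨M, hf⟩
  rw [_root_.abs_le]
  constructor
  · rw [← hφ.const (-M)]
    exact hφ.mono _ _ (.const _) hb fun x => (_root_.abs_le.1 (hf x)).1
  · rw [← hφ.const M]
    exact hφ.mono _ _ hb (.const _) fun x => (_root_.abs_le.1 (hf x)).2

theorem IsMean.eval {X : Type*} (x : X) : IsMean (fun f : X → ℝ => f x) :=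
  ⟨fun _ _ _ _ => rfl, fun _ _ _ _ h => h x, fun _ => rfl⟩

theorem IsMean.comp {X Y : Type*} {φ : (X → ℝ) → ℝ} (hφ : IsMean φ) (g : X → Y) :
    IsMean (fun f : Y → ℝ => φ (fun x => f (g x))) :=
  ⟨fun _ _ hf hh => hφ.add _ _ (hf.comp g) (hh.comp g),
    fun _ _ hf hh h => hφ.mono _ _ (hf.comp g) (hh.comp g) fun x => h (g x),
    fun c => hφ.const c⟩

theorem IsBdd.mean {X Y : Type*} {m : X → (Y → ℝ) → ℝ} (hm : ∀ x, IsMean (m x)) {f : Y → ℝ}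
    (hf : IsBdd f) : IsBdd (fun x => m x f) :=
  hf.imp fun _ h x => (hm x).abs_le h

theorem IsMean.bind {X Y : Type*} {φ : (X → ℝ) → ℝ} (hφ : IsMean φ) {m : X → (Y → ℝ) → ℝ}
    (hm : ∀ x, IsMean (m x)) : IsMean (fun f => φ (fun x => m x f)) := by
  refine ⟨fun f g hf hg => ?_, fun f g hf hg h => ?_, fun c => ?_⟩
  · rw [← hφ.add _ _ (hf.mean hm) (hg.mean hm)]
    congr 1
    funext x
    exact (hm x).add f g hf hg
  · exact hφ.mono _ _ (hf.mean hm) (hg.mean hm) fun x => (hm x).mono f g hf hg h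
  · simp only [(hm _).const, hφ.const]

/-- A convex set of functions with values in `[0, 1]`, each of which exceeds `c` somewhere, is
bounded below by `c` under some mean. -/
theorem exists_isMean_forall_le {X : Type*} [Nonempty X] {C : Set (X → ℝ)} (hC : Convex ℝ C)
    (h01 : ∀ f ∈ C, ∀ x, f x ∈ Set.Icc (0 : ℝ) 1) {c : ℝ} (hc : ∀ f ∈ C, ∃ x, c < f x) :
    ∃ φ : (X → ℝ) → ℝ, IsMean φ ∧ ∀ f ∈ C, c ≤ φ f := by
  classical
  rcases C.eq_empty_or_nonempty with rfl | ⟨f₀, hf₀⟩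
  · exact ⟨_, IsMean.eval (Classical.arbitrary X), by simp⟩
  -- With the discrete topology all bounded functions are continuous, and the sup norm gives `s` the
  -- interior points that separation needs.
  let _ : TopologicalSpace X := ⊥
  have : DiscreteTopology X := ⟨rfl⟩
  let s : Set (BoundedContinuousFunction X ℝ) := {g | ∀ x, g x ≤ c}
  let t : Set (BoundedContinuousFunction X ℝ) := {g | (⇑g) ∈ C}
  have hs : Convex ℝ s := by
    intro f hf g hg a b ha hb hab x
    have h1 := mul_le_mul_of_nonneg_left (hf x) ha
    have h2 := mul_le_mul_of_nonneg_left (hg x) hb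
    have h3 : a * c + b * c = c := by rw [← add_mul, hab, one_mul]
    simp only [BoundedContinuousFunction.coe_add, BoundedContinuousFunction.coe_smul,
      Pi.add_apply, smul_eq_mul]
    linarith
  have ht : Convex ℝ t := by
    intro f hf g hg a b ha hb hab
    exact hC hf hg ha hb hab
  have hdisj : Disjoint (interior s) t := by
    rw [Set.disjoint_left]
    intro g hg hgt
    obtain ⟨x, hx⟩ := hc _ hgt
    exact absurd (interior_subset hg x) (not_le.2 hx)
  obtain ⟨ψ, u, hψs, hψt⟩ := geometric_hahn_banach_open hs.interior isOpen_interior ht hdisj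
  have hint : ∀ (g : BoundedContinuousFunction X ℝ) (c' : ℝ), c' < c → (∀ x, g x ≤ c') →
      g ∈ interior s := by
    intro g c' hc' hg
    rw [mem_interior_iff_mem_nhds, Metric.mem_nhds_iff]
    refine ⟨c - c', sub_pos.2 hc', fun h hh x => ?_⟩
    have h1 := (BoundedContinuousFunction.dist_coe_le_dist (f := h) (g := g) x).trans_lt hh
    rw [Real.dist_eq] at h1
    have := (abs_lt.1 h1).2
    have := hg x
    linarith
  let mk : (f : X → ℝ) → IsBdd f → BoundedContinuousFunction X ℝ := fun f hf =>
    BoundedContinuousFunction.ofNormedAddCommGroupDiscrete f hf.choose hf.choose_spec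
  let one : BoundedContinuousFunction X ℝ := BoundedContinuousFunction.const X 1
  have hpos : ∀ h : BoundedContinuousFunction X ℝ, (∀ x, 0 ≤ h x) → 0 ≤ ψ h := by
    intro h hh
    by_contra! hneg
    -- If `ψ h < 0`, subtracting this multiple of `h` keeps the function below `c` but lifts `ψ` to
    -- at least `u`.
    let r : ℝ := max 0 ((u - (c - 1) * ψ one) / -ψ h)
    have hr : 0 ≤ r := le_max_left _ _
    have h1 := hψs ((c - 1) • one - r • h) (hint _ (c - 1) (by linarith) fun x => by
      have := mul_nonneg hr (hh x)
      simp [one]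
      linarith)
    rw [map_sub, map_smul, map_smul, smul_eq_mul, smul_eq_mul] at h1
    have h2 : (u - (c - 1) * ψ one) / -ψ h ≤ r := le_max_right _ _
    rw [div_le_iff₀ (by linarith)] at h2
    linarith
  have hmono : ∀ f g : BoundedContinuousFunction X ℝ, (∀ x, f x ≤ g x) → ψ f ≤ ψ g := by
    intro f g h
    have := hpos (g - f) fun x => by simpa using h x
    rw [map_sub] at this
    linarith
  have hbd : ∀ f ∈ C, IsBdd f := fun f hf =>
    ⟨1, fun x => abs_le.2 ⟨by linarith [(h01 f hf x).1], (h01 f hf x).2⟩⟩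
  have hlow : ∀ c' < c, c' * ψ one < u := by
    intro c' hc'
    have h1 := hψs (c' • one) (hint _ c' hc' fun x => by simp [one])
    simpa using h1
  -- If `ψ one = 0`, then `f₀ ≤ 1` gives `u ≤ ψ f₀ ≤ 0`, whereas `hlow` gives `0 < u`.
  have hone : 0 < ψ one := by
    refine lt_of_le_of_ne (hpos one fun x => by simp [one]) fun h0 => ?_
    have h1 : u ≤ ψ (mk f₀ (hbd f₀ hf₀)) := hψt _ hf₀
    have h2 : ψ (mk f₀ (hbd f₀ hf₀)) ≤ ψ one := hmono _ _ fun x => (h01 f₀ hf₀ x).2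
    have h3 := hlow (c - 1) (by linarith)
    rw [← h0] at h2 h3
    linarith
  let φ : (X → ℝ) → ℝ := fun f => if hf : IsBdd f then ψ (mk f hf) / ψ one else 0
  have hφ : ∀ f (hf : IsBdd f), φ f = ψ (mk f hf) / ψ one := fun f hf => dif_pos hf
  refine ⟨φ, ⟨fun f g hf hg => ?_, fun f g hf hg h => ?_, fun a => ?_⟩, fun f hf => ?_⟩
  · rw [hφ _ hf, hφ _ hg, hφ _ (hf.add hg), ← add_div, ← map_add]
    rfl
  · rw [hφ _ hf, hφ _ hg]
    exact div_le_div_of_nonneg_right (hmono _ _ h) hone.le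
  · have h1 : mk (fun _ => a) (.const a) = a • one := by
      ext x
      simp [mk, one]
    rw [hφ _ (.const a), h1, map_smul, smul_eq_mul, mul_div_cancel_right₀ _ hone.ne']
  · rw [hφ _ (hbd f hf)]
    refine le_of_forall_lt fun c' hc' => ?_
    rw [lt_div_iff₀ hone]
    exact (hlow c' hc').trans_le (hψt _ hf)

/-! ### The Cesàro mean of a sequence -/

/-- The average of the first `N` terms. -/
noncomputable def average (a : ℕ → ℝ) (N : ℕ) : ℝ := (N : ℝ)⁻¹ * ∑ k ∈ Finset.range N, a k

/-- The limit of the averages along a nonprincipal ultrafilter. -/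
noncomputable def cesaroMean (a : ℕ → ℝ) : ℝ :=
  limUnder (hyperfilter ℕ : Filter ℕ) (average a)

theorem hyperfilter_le_atTop : (hyperfilter ℕ : Filter ℕ) ≤ atTop :=
  Nat.cofinite_eq_atTop ▸ hyperfilter_le_cofinite

theorem average_mono {a b : ℕ → ℝ} (h : a ≤ b) (N : ℕ) : average a N ≤ average b N :=
  mul_le_mul_of_nonneg_left (Finset.sum_le_sum fun k _ => h k) (by positivity)

theorem tendsto_average_cesaroMean {a : ℕ → ℝ} (ha : IsBdd a) :
    Tendsto (average a) (hyperfilter ℕ) (𝓝 (cesaroMean a)) := by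
  obtain ⟨M, hM⟩ := ha
  have hM0 : 0 ≤ M := (abs_nonneg _).trans (hM 0)
  have hb : ∀ N, average a N ∈ Set.Icc (-M) M := by
    intro N
    rw [Set.mem_Icc, ← abs_le, average, abs_mul, abs_inv, Nat.abs_cast]
    rcases Nat.eq_zero_or_pos N with rfl | hN
    · simpa using hM0
    · have hN' : (0 : ℝ) < N := by exact_mod_cast hN
      rw [inv_mul_le_iff₀ hN']
      calc |∑ k ∈ Finset.range N, a k| ≤ ∑ k ∈ Finset.range N, |a k| :=
            Finset.abs_sum_le_sum_abs _ _
        _ ≤ ∑ _k ∈ Finset.range N, M := Finset.sum_le_sum fun k _ => hM k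
        _ = N * M := by simp
  obtain ⟨l, -, hl⟩ := (isCompact_Icc (a := -M) (b := M)).ultrafilter_le_nhds
    ((hyperfilter ℕ).map (average a)) (by
      rw [le_principal_iff]
      exact Filter.mem_map.2 (Filter.univ_mem' hb))
  exact tendsto_nhds_limUnder ⟨l, hl⟩

theorem cesaroMean_of_tendsto {a : ℕ → ℝ} {l : ℝ} (h : Tendsto a atTop (𝓝 l)) :
    cesaroMean a = l :=
  (h.cesaro.mono_left hyperfilter_le_atTop).limUnder_eq

theorem isMean_cesaroMean : IsMean cesaroMean := by
  refine ⟨fun a b ha hb => ?_, fun a b ha hb h => ?_, fun c => ?_⟩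
  · refine tendsto_nhds_unique (tendsto_average_cesaroMean (ha.add hb)) ?_
    refine ((tendsto_average_cesaroMean ha).add (tendsto_average_cesaroMean hb)).congr fun N => ?_
    simp [average, Finset.sum_add_distrib, mul_add]
  · exact le_of_tendsto_of_tendsto' (tendsto_average_cesaroMean ha)
      (tendsto_average_cesaroMean hb) (average_mono h)
  · exact cesaroMean_of_tendsto tendsto_const_nhds

/-- Division by `n` is injective on a residue class, so at most `N / n + 1` of the first `N`
integers lie in it. -/
theorem cesaroMean_residue_le {n : ℕ} (hn : 0 < n) (r : ℕ) :
    cesaroMean ({k | k % n = r}.indicator 1) ≤ (n : ℝ)⁻¹ := by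
  have hn' : (0 : ℝ) < n := by exact_mod_cast hn
  have hbound : ∀ N : ℕ, 0 < N →
      average ({k | k % n = r}.indicator 1) N ≤ (n : ℝ)⁻¹ + (N : ℝ)⁻¹ := by
    intro N hN
    have hN' : (0 : ℝ) < N := by exact_mod_cast hN
    have hinj : ((Finset.range N).filter fun k => k % n = r).card ≤ N / n + 1 := by
      rw [← Finset.card_range (N / n + 1)]
      refine Finset.card_le_card_of_injOn (fun k => k / n) ?_ ?_
      · intro k hk
        simp only [Finset.coe_filter, Finset.mem_range, Set.mem_ofPred_eq] at hk
        simp only [Finset.coe_range, Set.mem_Iio]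
        exact Nat.lt_succ_of_le (Nat.div_le_div_right hk.1.le)
      · intro k hk j hj hkj
        simp only [Finset.coe_filter, Finset.mem_range, Set.mem_ofPred_eq] at hk hj
        have hkj' : k / n = j / n := hkj
        rw [← Nat.div_add_mod k n, ← Nat.div_add_mod j n, hk.2, hj.2, hkj']
    have hsum : ∑ k ∈ Finset.range N, ({k | k % n = r}.indicator (1 : ℕ → ℝ)) k
        = ((Finset.range N).filter fun k => k % n = r).card := by
      rw [Finset.card_filter, Nat.cast_sum]
      refine Finset.sum_congr rfl fun k _ => ?_
      by_cases h : k % n = r <;> simp [h]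
    rw [average, hsum, inv_mul_le_iff₀ hN']
    calc (((Finset.range N).filter fun k => k % n = r).card : ℝ) ≤ ((N / n + 1 : ℕ) : ℝ) := by
          exact_mod_cast hinj
      _ ≤ (N : ℝ) / n + 1 := by
          push_cast
          gcongr
          exact Nat.cast_div_le
      _ = N * ((n : ℝ)⁻¹ + (N : ℝ)⁻¹) := by field_simp
  have hlim : Tendsto (fun N : ℕ => (n : ℝ)⁻¹ + (N : ℝ)⁻¹) atTop (𝓝 ((n : ℝ)⁻¹ + 0)) :=
    tendsto_const_nhds.add tendsto_inv_atTop_nhds_zero_nat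
  rw [add_zero] at hlim
  refine le_of_tendsto_of_tendsto (tendsto_average_cesaroMean (.indicator_one _))
    (hlim.mono_left hyperfilter_le_atTop) ?_
  exact hyperfilter_le_atTop ((eventually_gt_atTop 0).mono hbound)

/-! ### Finitely additive probabilities -/

/-- The finitely additive probability induced by a mean. -/
noncomputable def IsMean.toFinAddProb (S : EventAlgebra) {φ : (Paths → ℝ) → ℝ} (hφ : IsMean φ) :
    FinAddProb S where
  prob E := φ (E.1.indicator 1)
  nonneg E := by
    rw [← hφ.const 0]
    exact hφ.mono _ _ (.const _) (.indicator_one _)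
      fun x => Set.indicator_nonneg (fun _ _ => zero_le_one) x
  prob_univ := by
    rw [Set.indicator_univ]
    exact hφ.const 1
  prob_union E F h := by
    rw [Set.indicator_union_of_disjoint h]
    exact hφ.add _ _ (.indicator_one _) (.indicator_one _)

theorem FinAddProb.prob_mono {S : EventAlgebra} (P : FinAddProb S) {E F : Event S}
    (h : E.1 ⊆ F.1) : P.prob E ≤ P.prob F := by
  have h1 := P.prob_union E ⟨F.1 \ E.1, @MeasurableSet.diff _ S.sigma _ _ F.2 E.2⟩
    Set.disjoint_sdiff_right
  have h2 : (⟨E.1 ∪ F.1 \ E.1, @MeasurableSet.union _ S.sigma _ _ E.2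
      (@MeasurableSet.diff _ S.sigma _ _ F.2 E.2)⟩ : Event S) = F :=
    Subtype.ext (Set.union_sdiff_cancel h)
  rw [h2] at h1
  rw [h1]
  exact le_add_of_nonneg_right (P.nonneg _)

theorem FinAddProb.prob_le_add {S : EventAlgebra} (P : FinAddProb S) {A E F : Event S}
    (h : A.1 ⊆ E.1 ∪ F.1) : P.prob A ≤ P.prob E + P.prob F := by
  let D : Event S := ⟨F.1 \ E.1, @MeasurableSet.diff _ S.sigma _ _ F.2 E.2⟩
  have h1 := P.prob_union E D Set.disjoint_sdiff_right
  have h2 : P.prob D ≤ P.prob F := P.prob_mono Set.sdiff_subset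
  have h3 : P.prob A ≤ P.prob ⟨E.1 ∪ D.1, @MeasurableSet.union _ S.sigma _ _ E.2 D.2⟩ :=
    P.prob_mono (h.trans Set.union_sdiff_self.superset)
  linarith

/-- For every `η > 0` the space is covered by finitely many events of probability at most `η`. -/
def FinAddProb.HasSmallCovers {S : EventAlgebra} (P : FinAddProb S) : Prop :=
  ∀ η : ℝ, 0 < η → ∃ (m : ℕ) (E : ℕ → Event S), (∀ i, P.prob (E i) ≤ η) ∧
    ∀ ω, ∃ i < m, ω ∈ (E i).1

/-- Adding the pieces of a small cover to `A` one at a time, within `B`, raises the probability by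
at most `η` per step. The bracket is the pair of stages around the first one reaching `c`. -/
theorem FinAddProb.HasSmallCovers.exists_squeeze {S : EventAlgebra} {P : FinAddProb S}
    (hP : P.HasSmallCovers) {A B : Event S} (hAB : A.1 ⊆ B.1) {c : ℝ} (hA : P.prob A ≤ c)
    (hB : c ≤ P.prob B) {η : ℝ} (hη : 0 < η) :
    ∃ A' B' : Event S, A.1 ⊆ A'.1 ∧ A'.1 ⊆ B'.1 ∧ B'.1 ⊆ B.1 ∧ P.prob A' ≤ c ∧
      c ≤ P.prob B' ∧ P.prob B' ≤ P.prob A' + η := by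
  classical
  obtain ⟨m, E, hE, hcov⟩ := hP η hη
  let C : ℕ → Event S := fun j => ⟨A.1 ∪ (B.1 ∩ ⋃ i : {i // i < j}, (E i).1),
    @MeasurableSet.union _ S.sigma _ _ A.2 (@MeasurableSet.inter _ S.sigma _ _ B.2
      (@MeasurableSet.iUnion _ _ S.sigma _ _ fun i => (E i).2))⟩
  have hCB : ∀ j, (C j).1 ⊆ B.1 := fun j => Set.union_subset hAB Set.inter_subset_left
  have hAC : ∀ j, A.1 ⊆ (C j).1 := fun j => Set.subset_union_left
  have hm : c ≤ P.prob (C m) := by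
    refine hB.trans (P.prob_mono fun ω hω => Or.inr ⟨hω, ?_⟩)
    obtain ⟨i, hi, h⟩ := hcov ω
    exact Set.mem_iUnion.2 ⟨⟨i, hi⟩, h⟩
  have hex : ∃ j, c ≤ P.prob (C j) := ⟨m, hm⟩
  have hspec := Nat.find_spec hex
  rcases hj : Nat.find hex with _ | j
  -- Stage `0` is `A` itself, so here `P.prob A = c` and both ends can be `A`.
  · rw [hj] at hspec
    have h0 : (C 0).1 ⊆ A.1 := by
      refine Set.union_subset le_rfl ?_
      rintro ω ⟨-, h⟩
      obtain ⟨i, -⟩ := Set.mem_iUnion.1 h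
      exact absurd i.2 (Nat.not_lt_zero _)
    exact ⟨A, A, le_rfl, le_rfl, hAB, hA, hspec.trans (P.prob_mono h0), by linarith⟩
  · rw [hj] at hspec
    have hlt : P.prob (C j) < c :=
      not_le.1 (Nat.find_min hex (by rw [hj]; exact Nat.lt_succ_self j))
    refine ⟨C j, C (j + 1), hAC j, ?_, hCB _, hlt.le, hspec, ?_⟩
    · rintro ω (h | ⟨hB, h⟩)
      · exact Or.inl h
      · obtain ⟨i, hi⟩ := Set.mem_iUnion.1 h
        exact Or.inr ⟨hB, Set.mem_iUnion.2 ⟨⟨i, i.2.trans (Nat.lt_succ_self j)⟩, hi⟩⟩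
    · refine (P.prob_le_add (E := C j) (F := E j) ?_).trans (by linarith [hE j])
      rintro ω (h | ⟨hB, h⟩)
      · exact Or.inl (Or.inl h)
      · obtain ⟨⟨i, hij⟩, hi⟩ := Set.mem_iUnion.1 h
        rcases (Nat.lt_succ_iff_lt_or_eq.1 hij) with h' | rfl
        · exact Or.inl (Or.inr ⟨hB, Set.mem_iUnion.2 ⟨⟨i, h'⟩, hi⟩⟩)
        · exact Or.inr hi

/-- Iterated squeezing gives nested brackets around the target value with gaps tending to `0`. The
union of the lower ends lies in every bracket, so monotonicity fixes its probability; no countable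
additivity is used. -/
theorem FinAddProb.HasSmallCovers.stronglyNonatomic {S : EventAlgebra} {P : FinAddProb S}
    (hP : P.HasSmallCovers) : P.StronglyNonatomic := by
  rintro E α ⟨hα0, hα1⟩
  let c : ℝ := α * P.prob E
  have hc0 : 0 ≤ c := mul_nonneg hα0 (P.nonneg E)
  have hc1 : c ≤ P.prob E := mul_le_of_le_one_left (P.nonneg E) hα1
  let Bracket : Type := {p : Event S × Event S //
    p.1.1 ⊆ p.2.1 ∧ P.prob p.1 ≤ c ∧ c ≤ P.prob p.2}
  have hstep : ∀ (n : ℕ) (p : Bracket), ∃ q : Bracket, p.1.1.1 ⊆ q.1.1.1 ∧ q.1.2.1 ⊆ p.1.2.1 ∧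
      P.prob q.1.2 ≤ P.prob q.1.1 + 1 / ((n : ℝ) + 1) := by
    rintro n ⟨⟨A, B⟩, hAB, hA, hB⟩
    obtain ⟨A', B', h1, h2, h3, h4, h5, h6⟩ :=
      hP.exists_squeeze hAB hA hB (η := 1 / ((n : ℝ) + 1)) (by positivity)
    exact ⟨⟨⟨A', B'⟩, h2, h4, h5⟩, h1, h3, h6⟩
  choose next hnext using hstep
  let empty : Event S := ⟨∅, @MeasurableSet.empty _ S.sigma⟩
  have hempty : P.prob empty ≤ c := by
    have h1 := P.prob_union empty empty (Set.disjoint_empty _)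
    have h2 : (⟨empty.1 ∪ empty.1, @MeasurableSet.union _ S.sigma _ _ empty.2 empty.2⟩ : Event S)
        = empty := Subtype.ext (Set.union_self _)
    rw [h2] at h1
    linarith
  let p : ℕ → Bracket := fun n =>
    Nat.rec ⟨(empty, E), Set.empty_subset _, hempty, hc1⟩ next n
  have hp : ∀ n, p (n + 1) = next n (p n) := fun n => rfl
  have hlo : Monotone fun n => (p n).1.1.1 := monotone_nat_of_le_succ fun n => by
    rw [hp]; exact (hnext n (p n)).1
  have hhi : Antitone fun n => (p n).1.2.1 := antitone_nat_of_succ_le fun n => by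
    rw [hp]; exact (hnext n (p n)).2.1
  let F : Event S := ⟨⋃ n, (p n).1.1.1, @MeasurableSet.iUnion _ _ S.sigma _ _ fun n => (p n).1.1.2⟩
  have hFlo : ∀ n, (p n).1.1.1 ⊆ F.1 := fun n => Set.subset_iUnion (fun n => (p n).1.1.1) n
  have hFhi : ∀ n, F.1 ⊆ (p n).1.2.1 := fun n => Set.iUnion_subset fun k =>
    (hlo (le_max_left k n)).trans ((p (max k n)).2.1.trans (hhi (le_max_right k n)))
  refine ⟨F, hFhi 0, ?_⟩
  change P.prob F = c
  have hclose : ∀ n : ℕ, |P.prob F - c| ≤ 1 / ((n : ℝ) + 1) := by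
    intro n
    have h1 := (hnext n (p n)).2.2
    rw [← hp] at h1
    have h2 := P.prob_mono (hFlo (n + 1))
    have h3 := P.prob_mono (hFhi (n + 1))
    have h4 := (p (n + 1)).2.2.1
    have h5 := (p (n + 1)).2.2.2
    rw [abs_le]
    constructor <;> linarith
  have h0 : |P.prob F - c| ≤ 0 := ge_of_tendsto' tendsto_one_div_add_atTop_nhds_zero_nat hclose
  linarith [abs_nonpos_iff.1 h0]

/-! ### Nonatomic opinions dominating a mean on open sets -/

/-- The path that follows `ω` before period `k`, has a `1` at `k`, and `0` afterwards. -/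
def truncate (ω : Paths) (k : ℕ) : Paths := fun j => if j < k then ω j else if j = k then 1 else 0

/-- The paths whose last `1` is at period `k`. -/
def lastOneAt (k : ℕ) : Set Paths := {ω | ω k = 1 ∧ ∀ j, k < j → ω j = 0}

theorem truncate_mem_lastOneAt (ω : Paths) (k : ℕ) : truncate ω k ∈ lastOneAt k := by
  refine ⟨by simp [truncate], fun j hj => ?_⟩
  simp [truncate, hj.not_gt, hj.ne']

theorem eq_of_mem_lastOneAt {ω : Paths} {j k : ℕ} (hj : ω ∈ lastOneAt j)
    (hk : ω ∈ lastOneAt k) : j = k := by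
  rcases lt_trichotomy j k with h | h | h
  · exact absurd ((hj.2 k h).symm.trans hk.1) (by decide)
  · exact h
  · exact absurd ((hk.2 j h).symm.trans hj.1) (by decide)

theorem isClosed_lastOneAt (k : ℕ) : IsClosed (lastOneAt k) := by
  have h : lastOneAt k = {ω : Paths | ω k = 1} ∩ ⋂ j, ⋂ (_ : k < j), {ω : Paths | ω j = 0} := by
    ext ω
    simp [lastOneAt]
  rw [h]
  exact (isClosed_eq (continuous_apply k) continuous_const).inter
    (isClosed_iInter fun j => isClosed_iInter fun _ =>
      isClosed_eq (continuous_apply j) continuous_const)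

theorem tendsto_truncate (ω : Paths) : Tendsto (truncate ω) atTop (𝓝 ω) := by
  rw [tendsto_pi_nhds]
  intro j
  refine tendsto_const_nhds.congr' ?_
  filter_upwards [eventually_gt_atTop j] with k hk
  simp [truncate, hk]

/-- The Cesàro mean along the truncations of a path. -/
noncomputable def truncationMean (ω : Paths) (f : Paths → ℝ) : ℝ :=
  cesaroMean fun k => f (truncate ω k)

theorem isMean_truncationMean (ω : Paths) : IsMean (truncationMean ω) :=
  isMean_cesaroMean.comp (truncate ω)

theorem truncationMean_isOpen {U : Set Paths} (hU : IsOpen U) {ω : Paths} (hω : ω ∈ U) :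
    truncationMean ω (U.indicator 1) = 1 := by
  refine cesaroMean_of_tendsto (tendsto_const_nhds.congr' ?_)
  filter_upwards [(tendsto_truncate ω).eventually (hU.mem_nhds hω)] with k hk
  exact (Set.indicator_of_mem hk 1).symm

/-- The paths whose last `1` is at a period congruent to `r` modulo `n`. -/
def residueEvent (S : EventAlgebra) (n r : ℕ) : Event S :=
  ⟨⋃ k : {k // k % n = r}, lastOneAt k, @MeasurableSet.iUnion _ _ S.sigma _ _ fun k =>
    (@MeasurableSet.compl_iff _ _ S.sigma).1
      (S.measurableSet_of_isOpen (isClosed_lastOneAt k).isOpen_compl)⟩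

/-- The paths without a last `1`. -/
def noLastOneEvent (S : EventAlgebra) : Event S :=
  ⟨⋂ k, (lastOneAt k)ᶜ, @MeasurableSet.iInter _ _ S.sigma _ _ fun k =>
    S.measurableSet_of_isOpen (isClosed_lastOneAt k).isOpen_compl⟩

theorem truncate_mem_residueEvent (S : EventAlgebra) (ω : Paths) (k n r : ℕ) :
    truncate ω k ∈ (residueEvent S n r).1 ↔ k % n = r := by
  constructor
  · intro h
    obtain ⟨⟨j, hj⟩, h⟩ := Set.mem_iUnion.1 h
    rwa [eq_of_mem_lastOneAt (truncate_mem_lastOneAt ω k) h]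
  · intro h
    exact Set.mem_iUnion.2 ⟨⟨k, h⟩, truncate_mem_lastOneAt ω k⟩

/-- The bounds hold for each `truncationMean ω` uniformly in `ω`, so they survive averaging by `φ`.
-/
theorem hasSmallCovers_bind_truncationMean (S : EventAlgebra) {φ : (Paths → ℝ) → ℝ}
    (hφ : IsMean φ) :
    ((hφ.bind isMean_truncationMean).toFinAddProb S).HasSmallCovers := by
  intro η hη
  obtain ⟨n, hn⟩ := exists_nat_one_div_lt hη
  have key : ∀ E : Event S, (∀ ω, truncationMean ω (E.1.indicator 1) ≤ η) →
      ((hφ.bind isMean_truncationMean).toFinAddProb S).prob E ≤ η := by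
    intro E h
    refine (hφ.mono _ _ ?_ (.const η) h).trans_eq (hφ.const η)
    exact (IsBdd.indicator_one E.1).mean isMean_truncationMean
  -- The `n + 1` residue classes miss only the paths without a last `1`. That remainder is null
  -- because it contains no truncation.
  refine ⟨n + 2, fun i => if i < n + 1 then residueEvent S (n + 1) i else noLastOneEvent S,
    fun i => key _ fun ω => ?_, fun ω => ?_⟩
  · beta_reduce
    split_ifs with hi
    · have h : truncationMean ω ((residueEvent S (n + 1) i).1.indicator 1)
          = cesaroMean ({k | k % (n + 1) = i}.indicator 1) := by
        refine congrArg cesaroMean (funext fun k => ?_)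
        have := truncate_mem_residueEvent S ω k (n + 1) i
        by_cases hk : k % (n + 1) = i
        · rw [Set.indicator_of_mem (this.2 hk)]
          simp [hk]
        · rw [Set.indicator_of_notMem (mt this.1 hk)]
          simp [hk]
      rw [h]
      refine (cesaroMean_residue_le n.succ_pos i).trans ?_
      rw [one_div] at hn
      exact_mod_cast hn.le
    · have h : truncationMean ω ((noLastOneEvent S).1.indicator 1) = cesaroMean fun _ => 0 := by
        refine congrArg cesaroMean (funext fun k => Set.indicator_of_notMem (fun h => ?_) _)
        exact Set.mem_iInter.1 h k (truncate_mem_lastOneAt ω k)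
      rw [h, isMean_cesaroMean.const]
      exact hη.le
  · by_cases h : ∃ k, ω ∈ lastOneAt k
    · obtain ⟨k, hk⟩ := h
      have hlt : k % (n + 1) < n + 1 := Nat.mod_lt _ n.succ_pos
      refine ⟨k % (n + 1), by omega, ?_⟩
      beta_reduce
      rw [if_pos hlt]
      exact Set.mem_iUnion.2 ⟨⟨k, rfl⟩, hk⟩
    · refine ⟨n + 1, by omega, ?_⟩
      beta_reduce
      rw [if_neg (lt_irrefl _)]
      exact Set.mem_iInter.2 fun k hk => h ⟨k, hk⟩

/-- Every mean is dominated on the open sets by an opinion. -/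
theorem exists_opinion_ge_on_opens (S : EventAlgebra) {φ : (Paths → ℝ) → ℝ} (hφ : IsMean φ) :
    ∃ P : Opinion S, ∀ U : TopologicalSpace.Opens Paths,
      φ ((U : Set Paths).indicator 1) ≤ P.1.prob (openEvent S U) := by
  refine ⟨⟨_, (hasSmallCovers_bind_truncationMean S hφ).stronglyNonatomic⟩, fun U => ?_⟩
  -- Domination holds pointwise in `ω`: the truncation mean of `U` is `1` on `U` and nonnegative
  -- elsewhere.
  refine hφ.mono _ _ (.indicator_one _)
    ((IsBdd.indicator_one _).mean isMean_truncationMean) fun ω => ?_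
  by_cases hω : ω ∈ (U : Set Paths)
  · rw [Set.indicator_of_mem hω]
    exact (truncationMean_isOpen U.isOpen hω).ge
  · rw [Set.indicator_of_notMem hω, ← (isMean_truncationMean ω).const 0]
    exact (isMean_truncationMean ω).mono _ _ (.const 0) (.indicator_one _)
      fun x => Set.indicator_nonneg (fun _ _ => zero_le_one) x

/-! ### Strategies and convex combinations -/

/-- A convex combination of rejection indicators is realised by a strategy. -/
theorem exists_strategy_of_mem_convexHull {S : EventAlgebra} (T : Test S) {f : Paths → ℝ}
    (hf : f ∈ convexHull ℝ (Set.range fun P : Opinion S => (T P : Set Paths).indicator 1)) :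
    ∃ ζ : Strategy S, ∀ ω, Strategy.probOf ζ {P | ω ∉ T P} = 1 - f ω := by
  classical
  obtain ⟨ι, _, w, z, hw0, hw1, hz, hzf⟩ := mem_convexHull_iff_exists_fintype.1 hf
  choose P hP using hz
  have hsum : ∑ i, ENNReal.ofReal (w i) = 1 := by
    rw [← ENNReal.ofReal_sum_of_nonneg fun i _ => hw0 i, hw1, ENNReal.ofReal_one]
  let p : PMF ι := PMF.ofFintype (fun i => ENNReal.ofReal (w i)) hsum
  refine ⟨⟨p.map P, ?_⟩, fun ω => ?_⟩
  · rw [PMF.support_map]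
    exact (Set.toFinite _).image _
  · have h1 : f ω = ∑ i, w i * (T (P i) : Set Paths).indicator 1 ω := by
      rw [← hzf, Finset.sum_apply]
      refine Finset.sum_congr rfl fun i _ => ?_
      rw [← hP i]
      rfl
    rw [Strategy.probOf, PMF.toOuterMeasure_map_apply, PMF.toOuterMeasure_apply_fintype,
      ENNReal.toReal_sum, h1, ← hw1, ← Finset.sum_sub_distrib]
    · refine Finset.sum_congr rfl fun i _ => ?_
      by_cases h : ω ∈ T (P i)
      · simp [h]
      · simp [h, p, hw0 i]
    · intro i _
      by_cases h : ω ∈ T (P i) <;> simp [h, p]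

end OpinionTesting

theorem theorem2 (S : OpinionTesting.EventAlgebra) (ε : ℝ) (hε₀ : 0 ≤ ε) (hε₁ : ε < 1)
    (T : OpinionTesting.Test S)
    (hT : OpinionTesting.Test.ControlsTypeI T Set.univ ε)
    (δ : ℝ) (hδ : δ ∈ Set.Ioc (0 : ℝ) (1 - ε)) :
    OpinionTesting.Test.CanBeManipulated T (1 - ε - δ) := by
  by_contra hman
  simp only [OpinionTesting.Test.CanBeManipulated, not_exists, not_forall, not_le] at hman
  let C : Set (OpinionTesting.Paths → ℝ) := convexHull ℝ
    (Set.range fun P : OpinionTesting.Opinion S => (T P : Set OpinionTesting.Paths).indicator 1)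
  have h01 : ∀ f ∈ C, ∀ ω, f ω ∈ Set.Icc (0 : ℝ) 1 := by
    intro f hf ω
    have hsub : C ⊆ Set.Icc 0 1 := by
      refine convexHull_min ?_ (convex_Icc _ _)
      rintro _ ⟨P, rfl⟩
      exact ⟨fun x => Set.indicator_nonneg (fun _ _ => zero_le_one) x,
        fun x => Set.indicator_le_self' (fun _ _ => zero_le_one) x⟩
    exact ⟨(hsub hf).1 ω, (hsub hf).2 ω⟩
  have hex : ∀ f ∈ C, ∃ ω, ε + δ < f ω := by
    intro f hf
    obtain ⟨ζ, hζ⟩ := OpinionTesting.exists_strategy_of_mem_convexHull T hf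
    obtain ⟨ω, hω⟩ := hman ζ
    rw [hζ] at hω
    exact ⟨ω, by linarith⟩
  obtain ⟨φ, hφ, hφC⟩ :=
    OpinionTesting.exists_isMean_forall_le (convex_convexHull ℝ _) h01 hex
  obtain ⟨P, hP⟩ := OpinionTesting.exists_opinion_ge_on_opens S hφ
  -- Diagonal step: the bound for all rejection sets is applied to that of `P` itself.
  have h1 := hφC _ (subset_convexHull ℝ _ ⟨P, rfl⟩)
  have h2 := hT P (Set.mem_univ P)
  linarith [hP (T P), hδ.1]
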